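/- Let $p\ge 5$ be a prime, $q=p^n$, and let $F_q$ be the field with $q$ elements. Let $m=k\cdot l$, where $k>1$ is a divisor of $q-1$ and $l\ge 1$ is the multiplicative order of $q$ modulo $m$. Let $a\in F_q^*$ be such that $x^m-a$ is irreducible over $F_q$, and let $\theta$ be the coset of $x$ in the field $F_q(\theta)=F_q[x]/\langle x^m-a\rangle$. Put $$T=\Big\{(u_0,\dots,u_{l-1})\in\mathbb Z^l \ :\ 0\le u_i\le p-1 \text{ for all } i,\ \ \sum_{i=0}^{l-1}(ik+1)u_i<m\Big\},\qquad d_2=|T|.$$ If $b\in F_q^*$, then the multiplicative order of $\theta+b$ in $F_q(\theta)$ is at least $d_2$. If $l\ge 2$ or $k\ge 4$, then $d_2\ge 5^{\sqrt{l/2}}$. Moreover: (i) if $l\ge p^2+1$, then $$d_2\ \ge\ \left(\frac{p(p-1)}{160(l-1)}\right)^{\sqrt p}\exp\!\left(2.5\sqrt{\Big(1-\frac1p\Big)(l-1)}\right);$$ (ii) if $2\le l<p+1$, then $$d_2\ \ge\ \frac{\exp\big(2.5\sqrt{l-1}\big)}{13(l-1)}.$$ -/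

import Mathlib

/-- The set `T` of all integer vectors `(u_0, …, u_{l-1})` with `0 ≤ u_i ≤ p - 1` for all `i` and
`∑ i, (i * k + 1) * u_i < m`, as a finite set. -/
noncomputable def exponentVectors (p k l m : ℕ) : Finset (Fin l → ℤ) :=
  (Fintype.piFinset fun _ : Fin l => Finset.Icc (0 : ℤ) ((p : ℤ) - 1)).filter
    fun u => ∑ i : Fin l, (((i : ℕ) : ℤ) * (k : ℤ) + 1) * u i < (m : ℤ)

/-- Membership in `T`, spelled out. -/
theorem mem_exponentVectors (p k l m : ℕ) (u : Fin l → ℤ) :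
    u ∈ exponentVectors p k l m ↔
      (∀ i, 0 ≤ u i ∧ u i ≤ (p : ℤ) - 1) ∧
        ∑ i : Fin l, (((i : ℕ) : ℤ) * (k : ℤ) + 1) * u i < (m : ℤ) := by
  simp [exponentVectors]

/-! Order bound. Raising `θ + b` to the powers `q ^ i` gives `θ ^ (q ^ i) + b`, and reducing with `θ
^ m = a` turns this into a binomial `d θ ^ r + b` with `r = q ^ i % m`. As `q ≡ 1` mod `k` and `q`
has order `l` mod `m`, the residues `r` run through all `j * k + 1`, `j < l`
(`exists_pow_card_pow_eq`). A vector `u` in `T` makes the product of these conjugates to the powers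
`u j` a polynomial of degree below `m`, so equality in the field is equality of polynomials.
Lowest-order terms then recover the exponents mod `p` (`prod_binomial_pow_injective`). Hence `θ + b`
has at least `|T|` distinct powers.

Size of `T`. Multiplicities of a partition of `s < l` with every part used fewer than `p` times form
a vector of `T`. Glaisher's theorem replaces these by partitions into parts prime to `p`, and
stretching parts embeds all partitions of integers up to about `(1 - 1/p)(l - 1)`
(`partitionSum_le_card_exponentVectors`).

Growth of the partition sums `P(n)`. Their convolution recurrence is compared with that of the
coefficients of `exp (c x / (1 - x))`. Here `c = 25/16` lies below `∑ 1/k² = π²/6`, already below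
the sum over `k ≤ 12`, and `2√c = 2.5` is the growth rate in the bound `exp (2.5 √n) / (13 n)`
(`convexExpCoeff_le_partitionSum`, `exp_sqrt_div_le_partitionSum`). The explicit estimates follow,
with small `l` settled by finite counting. -/

section Partitions

open Finset

/-! ### Convolution recurrences for partition numbers and their sums -/

/-- The number of partitions of natural numbers not exceeding `n`. -/
noncomputable def partitionSum (n : ℕ) : ℕ :=
  ∑ s ∈ range (n + 1), Fintype.card s.Partition

/-- The convolution of `f` with the sequence taking the value `v` at `k * v` and zero elsewhere. -/
noncomputable def multiplesConv (k : ℕ) (f : ℕ → ℝ) (n : ℕ) : ℝ :=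
  ∑ v ∈ range (n + 1), if k * v ≤ n then (v : ℝ) * f (n - k * v) else 0

/-- Adding `k` copies of the part `v` to a partition of `n - k * v`. -/
def addParts (n k v : ℕ) (hv : 0 < v) (h : k * v ≤ n) (x : (n - k * v).Partition) :
    n.Partition where
  parts := x.parts + Multiset.replicate k v
  parts_pos := by
    intro i hi
    rcases Multiset.mem_add.1 hi with hi | hi
    · exact x.parts_pos hi
    · rw [Multiset.eq_of_mem_replicate hi]; exact hv
  parts_sum := by
    rw [Multiset.sum_add, x.parts_sum, Multiset.sum_replicate, smul_eq_mul]; omega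

theorem card_partition_sub_le (n k v : ℕ) (hv : 0 < v) (h : k * v ≤ n) :
    Fintype.card (n - k * v).Partition ≤
      #{x : n.Partition | k ≤ x.parts.count v} := by
  rw [← Finset.card_univ]
  refine Finset.card_le_card_of_injOn (addParts n k v hv h) ?_ ?_
  · intro x _
    simp [addParts]
  · intro x _ y _ hxy
    have := congrArg Nat.Partition.parts hxy
    simp only [addParts, add_left_inj] at this
    exact Nat.Partition.ext this

theorem sum_mul_count_parts (n R : ℕ) (hR : n < R) (x : n.Partition) :
    ∑ v ∈ range R, v * x.parts.count v = n := by
  have h : x.parts.toFinset ⊆ range R := by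
    intro i hi
    have := Nat.Partition.le_of_mem_parts (Multiset.mem_toFinset.1 hi)
    simp; omega
  have := Finset.sum_multiset_count_of_subset x.parts _ h
  rw [x.parts_sum] at this
  conv_rhs => rw [this]
  exact Finset.sum_congr rfl fun v _ => by rw [smul_eq_mul, mul_comm]

/-- Write `n` as the sum of the parts of each partition of `n` and count pairs. A part `v` of
multiplicity `c` contributes `v` once for each `k ≤ c`, and removing `k` copies of `v` leaves a
partition of `n - k * v`. Truncating at `K` makes this an inequality. -/
theorem sum_multiplesConv_card_partition_le (n K : ℕ) :
    ∑ k ∈ Icc 1 K, multiplesConv k (fun s => (Fintype.card s.Partition : ℝ)) n ≤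
      n * Fintype.card n.Partition := by
  have key : ∑ k ∈ Icc 1 K, ∑ v ∈ range (n + 1),
      (if k * v ≤ n then v * Fintype.card (n - k * v).Partition else 0) ≤
        n * Fintype.card n.Partition := by
    calc _ ≤ ∑ k ∈ Icc 1 K, ∑ v ∈ range (n + 1),
          v * #{x : n.Partition | k ≤ x.parts.count v} := by
          refine sum_le_sum fun k _ => sum_le_sum fun v _ => ?_
          split_ifs with h
          · rcases Nat.eq_zero_or_pos v with rfl | hv
            · simp
            · exact Nat.mul_le_mul_left _ (card_partition_sub_le n k v hv h)
          · exact Nat.zero_le _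
      _ = ∑ x : n.Partition, ∑ v ∈ range (n + 1),
          v * #{k ∈ Icc 1 K | k ≤ x.parts.count v} := by
          simp_rw [card_filter, mul_sum]
          rw [sum_comm]
          simp_rw [sum_comm (s := Icc 1 K)]
          rw [sum_comm]
      _ ≤ ∑ x : n.Partition, n := by
          refine sum_le_sum fun x _ => ?_
          conv_rhs => rw [← sum_mul_count_parts n (n + 1) n.lt_succ_self x]
          refine sum_le_sum fun v _ => Nat.mul_le_mul_left _ ?_
          calc _ ≤ #(Icc 1 (x.parts.count v)) := by
                refine card_le_card fun k hk => ?_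
                simp only [mem_filter, mem_Icc] at hk ⊢
                omega
            _ = _ := by simp
      _ = _ := by simp [mul_comm]
  have := (Nat.cast_le (α := ℝ)).2 key
  push_cast at this
  simpa [multiplesConv] using this

theorem partitionSum_succ (n : ℕ) :
    partitionSum (n + 1) = partitionSum n + Fintype.card (n + 1).Partition := by
  rw [partitionSum, sum_range_succ, ← partitionSum]

theorem partitionSum_zero : partitionSum 0 = 1 := by
  simp [partitionSum]

theorem multiplesConv_succ_partitionSum (k n : ℕ) (hk : 0 < k) :
    multiplesConv k (fun s => (partitionSum s : ℝ)) (n + 1) =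
      multiplesConv k (fun s => (partitionSum s : ℝ)) n +
        multiplesConv k (fun s => (Fintype.card s.Partition : ℝ)) (n + 1) := by
  have h : multiplesConv k (fun s => (partitionSum s : ℝ)) n =
      ∑ v ∈ range (n + 1 + 1),
        if k * v ≤ n then (v : ℝ) * (partitionSum (n - k * v) : ℝ) else 0 := by
    rw [sum_range_succ _ (n + 1), multiplesConv, if_neg (by nlinarith), add_zero]
  rw [h, multiplesConv, multiplesConv, ← sum_add_distrib]
  refine sum_congr rfl fun v _ => ?_
  by_cases h1 : k * v ≤ n
  · rw [if_pos h1, if_pos (by omega), if_pos (by omega),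
      show n + 1 - k * v = n - k * v + 1 by omega, partitionSum_succ]
    push_cast
    ring
  · by_cases h2 : k * v = n + 1
    · rw [if_pos h2.le, if_neg h1, if_pos h2.le, h2, Nat.sub_self, partitionSum_zero]
      simp
    · rw [if_neg (by omega), if_neg h1, if_neg (by omega), add_zero]

/-- Partial summation of the previous recurrence. The extra sum of `partitionSum j` comes from the
varying factor `n`; it later absorbs the error terms. -/
theorem sum_add_sum_multiplesConv_partitionSum_le (n K : ℕ) :
    ∑ j ∈ range n, (partitionSum j : ℝ) +
      ∑ k ∈ Icc 1 K, multiplesConv k (fun s => (partitionSum s : ℝ)) n ≤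
        n * partitionSum n := by
  induction n with
  | zero => simp [multiplesConv]
  | succ n ih =>
    have h := sum_multiplesConv_card_partition_le (n + 1) K
    rw [sum_range_succ, sum_congr rfl fun k hk =>
      multiplesConv_succ_partitionSum k n (mem_Icc.1 hk).1, sum_add_distrib, partitionSum_succ]
    push_cast at h ⊢
    linarith

/-! ### Comparing the convolutions for `k` and for `1` on convex sequences -/

theorem sum_range_mul_sub (A k : ℝ) (M : ℕ) :
    ∑ v ∈ range (M + 1), (v : ℝ) * (A - k * v) =
      M * (M + 1) / 6 * (3 * A - k * (2 * M + 1)) := by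
  induction M with
  | zero => simp
  | succ M ih => rw [sum_range_succ, ih]; push_cast; ring

theorem sum_range_mul_tsub (k N R : ℕ) (hk : 0 < k) (hR : N < R) :
    ∑ v ∈ range R, (v : ℝ) * ((N - k * v : ℕ) : ℝ) =
      (N / k : ℕ) * ((N / k : ℕ) + 1) / 6 * (3 * N - k * (2 * (N / k : ℕ) + 1)) := by
  rw [← sum_range_mul_sub]
  have h : N / k + 1 ≤ R := by have := Nat.div_le_self N k; omega
  rw [← sum_subset (range_subset_range.2 h)]
  · refine sum_congr rfl fun v hv => ?_
    have : v * k ≤ N := (Nat.le_div_iff_mul_le hk).1 (by simp at hv; omega)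
    rw [Nat.cast_sub (by linarith)]
    push_cast; ring
  · intro v _ hv
    have h1 : N / k < v := by simp at hv; omega
    have h2 := (Nat.div_lt_iff_lt_mul hk).1 h1
    rw [Nat.sub_eq_zero_of_le (by linarith)]
    simp

/-- Both sides agree when `k ∣ N`. Otherwise the remainder `r < k` adds only the nonnegative terms
`e1` and `e2`. -/
theorem sum_range_mul_tsub_ge (k N R : ℕ) (hk : 0 < k) (hR : N < R) :
    ∑ v ∈ range R, (v : ℝ) * ((N - 1 * v : ℕ) : ℝ) - ((k : ℝ) ^ 2 - 1) / 6 * N ≤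
      (k : ℝ) ^ 2 * ∑ v ∈ range R, (v : ℝ) * ((N - k * v : ℕ) : ℝ) := by
  rw [sum_range_mul_tsub k N R hk hR, sum_range_mul_tsub 1 N R one_pos hR]
  have h1 := Nat.div_add_mod N k
  have h2 := Nat.mod_lt N hk
  set M := N / k
  set r := N % k
  have hN : (N : ℝ) = k * M + r := by exact_mod_cast h1.symm
  have hr : (r : ℝ) ≤ k := by exact_mod_cast h2.le
  have hr0 : (0 : ℝ) ≤ r := r.cast_nonneg
  have hM0 : (0 : ℝ) ≤ M := M.cast_nonneg
  have hk0 : (0 : ℝ) ≤ k := k.cast_nonneg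
  have e1 : 0 ≤ 3 * (k * M * r) * ((k : ℝ) - r) :=
    mul_nonneg (by positivity) (by linarith)
  have e2 : 0 ≤ (r : ℝ) * ((k + r) * (k - r)) :=
    mul_nonneg hr0 (mul_nonneg (by positivity) (by linarith))
  rw [Nat.div_one, hN]
  push_cast
  nlinarith [e1, e2]

/-- The sequence `f` is determined by its second differences. -/
theorem exists_hinge_decomposition (f : ℕ → ℝ) (h0 : 0 ≤ f 0) (h1 : 2 * f 0 ≤ f 1)
    (h2 : ∀ n, 2 * f (n + 1) ≤ f (n + 2) + f n) :
    ∃ d : ℕ → ℝ, (∀ i, 0 ≤ d i) ∧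
      ∀ n, f n = ∑ i ∈ range (n + 1), d i * ((n + 1 - i : ℕ) : ℝ) := by
  -- `g` is `f` shifted by two, with value zero at the two new places, so `h0` and `h1` are
  -- convexity conditions at the left end.
  let g : ℕ → ℝ := fun n => if n = 0 then 0 else if n = 1 then 0 else f (n - 2)
  refine ⟨fun n => g (n + 2) - 2 * g (n + 1) + g n, ?_, ?_⟩
  · intro i
    rcases i with _ | _ | i
    · simpa [g] using h0
    · simp [g]; linarith
    · simp [g]; linarith [h2 i]
  · have key : ∀ n, ∑ i ∈ range n, (g (i + 2) - 2 * g (i + 1) + g i) = g (n + 1) - g n := by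
      intro n
      induction n with
      | zero => simp [g]
      | succ n ih => rw [sum_range_succ, ih]; ring
    have key2 : ∀ n, g (n + 1) = ∑ i ∈ range n, (g (i + 2) - 2 * g (i + 1) + g i) *
        ((n - i : ℕ) : ℝ) := by
      intro n
      induction n with
      | zero => simp [g]
      | succ n ih =>
        have : g (n + 2) = g (n + 1) + (g (n + 2) - g (n + 1)) := by ring
        rw [this, ← key (n + 1), ih, sum_range_succ, sum_range_succ _ n, ← add_assoc,
          ← sum_add_distrib]
        congr 1
        · refine sum_congr rfl fun i hi => ?_
          rw [show n + 1 - i = (n - i) + 1 by simp at hi; omega]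
          push_cast; ring
        · simp
    intro n
    have := key2 (n + 1)
    simpa [g] using this

/-- The claim is linear in `f`, and `f` is a nonnegative combination of hinges, so it reduces to
`sum_range_mul_tsub_ge`. -/
theorem multiplesConv_ge (f : ℕ → ℝ) (h0 : 0 ≤ f 0) (h1 : 2 * f 0 ≤ f 1)
    (h2 : ∀ n, 2 * f (n + 1) ≤ f (n + 2) + f n) (k n : ℕ) (hk : 0 < k) :
    multiplesConv 1 f n - ((k : ℝ) ^ 2 - 1) / 6 * f n ≤ (k : ℝ) ^ 2 * multiplesConv k f n := by
  obtain ⟨d, hd, hf⟩ := exists_hinge_decomposition f h0 h1 h2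
  have key : ∀ k, 0 < k → multiplesConv k f n =
      ∑ i ∈ range (n + 1), d i * ∑ v ∈ range (n + 2), (v : ℝ) * ((n + 1 - i - k * v : ℕ) : ℝ) := by
    intro k hk
    simp_rw [mul_sum]
    rw [sum_comm, sum_range_succ, multiplesConv]
    have h3 : ∑ i ∈ range (n + 1), d i * (((n + 1 : ℕ) : ℝ) *
        ((n + 1 - i - k * (n + 1) : ℕ) : ℝ)) = 0 := by
      refine sum_eq_zero fun i _ => ?_
      rw [show n + 1 - i - k * (n + 1) = 0 from Nat.sub_eq_zero_of_le ?_]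
      · simp
      · have := Nat.mul_le_mul_right (n + 1) hk
        omega
    rw [h3, add_zero]
    refine sum_congr rfl fun v _ => ?_
    split_ifs with h
    · rw [hf, mul_sum]
      have : range (n - k * v + 1) ⊆ range (n + 1) := range_subset_range.2 (by omega)
      rw [← sum_subset this]
      · refine sum_congr rfl fun i _ => ?_
        rw [show n + 1 - i - k * v = n - k * v + 1 - i by omega]
        ring
      · intro i _ hi
        simp only [mem_range] at hi
        rw [show n + 1 - i - k * v = 0 by omega]
        simp
    · symm
      refine sum_eq_zero fun i _ => ?_
      rw [show n + 1 - i - k * v = 0 by omega]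
      simp
  rw [key k hk, key 1 one_pos, hf, mul_sum, mul_sum, ← sum_sub_distrib]
  refine sum_le_sum fun i _ => ?_
  have := mul_le_mul_of_nonneg_left
    (sum_range_mul_tsub_ge k (n + 1 - i) (n + 2) hk (by omega)) (hd i)
  linarith

/-! ### The comparison sequence -/

/-- The coefficients of the power series `exp (c x / (1 - x))` with `c = 25 / 16`. -/
noncomputable def expCoeff : ℕ → ℝ
  | 0 => 1
  | 1 => 25 / 16
  | n + 2 => ((2 * (n + 1) + 25 / 16) * expCoeff (n + 1) - n * expCoeff n) / (n + 2)

theorem expCoeff_rec (n : ℕ) :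
    (n + 2) * expCoeff (n + 2) = (2 * (n + 1) + 25 / 16) * expCoeff (n + 1) - n * expCoeff n := by
  rw [expCoeff]
  have : (n : ℝ) + 2 ≠ 0 := by positivity
  field_simp

theorem expCoeff_pos_and_le_succ (n : ℕ) : 0 < expCoeff n ∧ expCoeff n ≤ expCoeff (n + 1) := by
  induction n with
  | zero => norm_num [expCoeff]
  | succ n ih =>
    obtain ⟨h1, h2⟩ := ih
    refine ⟨h1.trans_le h2, ?_⟩
    have h := expCoeff_rec n
    have hn : (0 : ℝ) ≤ n := n.cast_nonneg
    have h3 : (n + 2) * expCoeff (n + 1) ≤ (n + 2) * expCoeff (n + 2) := by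
      nlinarith
    exact le_of_mul_le_mul_left h3 (by positivity)

theorem expCoeff_pos (n : ℕ) : 0 < expCoeff n := (expCoeff_pos_and_le_succ n).1

theorem expCoeff_mono : Monotone expCoeff :=
  monotone_nat_of_le_succ fun n => (expCoeff_pos_and_le_succ n).2

theorem expCoeff_succ_le (n : ℕ) : expCoeff (n + 1) ≤ 2 * expCoeff n := by
  rcases n with _ | n
  · norm_num [expCoeff]
  · have h := expCoeff_rec n
    have hn : (0 : ℝ) ≤ n := n.cast_nonneg
    have h1 := expCoeff_pos n
    have h2 := expCoeff_pos (n + 1)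
    have h3 : (n + 2) * expCoeff (n + 2) ≤ (n + 2) * (2 * expCoeff (n + 1)) := by
      nlinarith [mul_nonneg hn h1.le]
    exact le_of_mul_le_mul_left h3 (by positivity)

theorem expCoeff_convex (n : ℕ) :
    2 * expCoeff (n + 2) ≤ expCoeff (n + 3) + expCoeff (n + 1) := by
  have h := expCoeff_rec (n + 1)
  have hn : (0 : ℝ) ≤ n := n.cast_nonneg
  have h1 := expCoeff_pos (n + 1)
  have h2 := expCoeff_succ_le (n + 1)
  push_cast at h
  have h3 : (n + 3) * (2 * expCoeff (n + 2)) ≤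
      (n + 3) * (expCoeff (n + 3) + expCoeff (n + 1)) := by
    rw [show n + 1 + 1 = n + 2 from rfl, show n + 1 + 2 = n + 3 from rfl] at *
    nlinarith
  exact le_of_mul_le_mul_left h3 (by positivity)

theorem multiplesConv_one (f : ℕ → ℝ) (n : ℕ) :
    multiplesConv 1 f n = ∑ i ∈ range n, ∑ j ∈ range (i + 1), f j := by
  have key : multiplesConv 1 f n = ∑ j ∈ range (n + 1), ((n : ℝ) - j) * f j := by
    rw [multiplesConv, ← sum_range_reflect]
    refine sum_congr rfl fun j hj => ?_
    have : j ≤ n := by simp at hj; omega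
    rw [if_pos (by omega), one_mul, show n + 1 - 1 - j = n - j by omega, Nat.sub_sub_self this,
      Nat.cast_sub this]
  rw [key]
  clear key
  induction n with
  | zero => simp
  | succ n ih =>
    rw [sum_range_succ, sum_range_succ (fun i => ∑ j ∈ range (i + 1), f j), ← ih,
      ← sum_add_distrib, sub_self, zero_mul, add_zero]
    exact sum_congr rfl fun j _ => by push_cast; ring

/-- Coefficient form of `x F' = c x / (1 - x)² · F` for `F = exp (c x / (1 - x))`. -/
theorem multiplesConv_one_expCoeff (n : ℕ) :
    25 / 16 * multiplesConv 1 expCoeff n = n * expCoeff n := by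
  have h : ∀ n : ℕ, 25 / 16 * ∑ j ∈ range (n + 1), expCoeff j =
      (n + 1) * expCoeff (n + 1) - n * expCoeff n := by
    intro n
    induction n with
    | zero => norm_num [expCoeff]
    | succ n ih =>
      rw [sum_range_succ, mul_add, ih]
      push_cast
      have := expCoeff_rec n
      rw [show n + 1 + 1 = n + 2 from rfl]
      linarith
  rw [multiplesConv_one]
  induction n with
  | zero => simp
  | succ n ih => rw [sum_range_succ, mul_add, ih, h]; push_cast; ring

/-- The sequence `expCoeff` with its value at `0` lowered to make it convex from `-1` on. -/
noncomputable def convexExpCoeff (n : ℕ) : ℝ := if n = 0 then 9 / 16 else expCoeff n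

theorem convexExpCoeff_of_ne {n : ℕ} (hn : n ≠ 0) : convexExpCoeff n = expCoeff n := if_neg hn

theorem convexExpCoeff_convex (n : ℕ) :
    2 * convexExpCoeff (n + 1) ≤ convexExpCoeff (n + 2) + convexExpCoeff n := by
  rcases n with _ | n
  · norm_num [convexExpCoeff, expCoeff]
  · simpa [convexExpCoeff] using expCoeff_convex n

theorem multiplesConv_one_convexExpCoeff (n : ℕ) :
    25 / 16 * multiplesConv 1 convexExpCoeff n = n * expCoeff n - 175 / 256 * n := by
  have : multiplesConv 1 convexExpCoeff n = multiplesConv 1 expCoeff n - 7 / 16 * n := by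
    rw [multiplesConv_one, multiplesConv_one]
    have h : ∀ i, ∑ j ∈ range (i + 1), convexExpCoeff j =
        ∑ j ∈ range (i + 1), expCoeff j - 7 / 16 := by
      intro i
      rw [sum_range_succ', sum_range_succ' expCoeff]
      norm_num [convexExpCoeff, expCoeff]
      ring
    simp_rw [h, sum_sub_distrib]
    simp
    ring
  rw [this, mul_sub, multiplesConv_one_expCoeff]
  ring

/-- Summing `multiplesConv_ge` over `k ≤ 12` gives main factor `∑ 1/k² ≥ 1.5649 > 25/16` and error
at most `(12 - 1.5649) / 6 < 1.7393` times `expCoeff n`. The term `175/256 * n` is the price of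
lowering the value at `0` by `7/16`. -/
theorem sum_multiplesConv_convexExpCoeff_ge (n : ℕ) (hn : n ≠ 0) :
    n * expCoeff n - 175 / 256 * n - 1.7393 * expCoeff n ≤
      ∑ k ∈ Icc 1 12, multiplesConv k convexExpCoeff n := by
  have h0 := multiplesConv_one_convexExpCoeff n
  have hW : 0 ≤ multiplesConv 1 convexExpCoeff n := by
    refine sum_nonneg fun v _ => ?_
    split_ifs
    · refine mul_nonneg v.cast_nonneg ?_
      rw [convexExpCoeff]
      split_ifs
      · norm_num
      · exact (expCoeff_pos _).le
    · exact le_rfl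
  have hE := expCoeff_pos n
  have h : ∀ k ∈ Icc (1 : ℕ) 12, multiplesConv 1 convexExpCoeff n * (1 / (k : ℝ) ^ 2) -
      (1 - 1 / (k : ℝ) ^ 2) / 6 * expCoeff n ≤ multiplesConv k convexExpCoeff n := by
    intro k hk
    have hk : 0 < k := (mem_Icc.1 hk).1
    have h := multiplesConv_ge convexExpCoeff (by norm_num [convexExpCoeff])
      (by norm_num [convexExpCoeff, expCoeff]) convexExpCoeff_convex k n hk
    rw [convexExpCoeff_of_ne hn] at h
    have hk2 : (0 : ℝ) < (k : ℝ) ^ 2 := by positivity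
    refine le_of_mul_le_mul_left ?_ hk2
    refine le_trans (le_of_eq ?_) h
    field_simp
  refine le_trans ?_ (sum_le_sum h)
  have hA : 1.5649 ≤ ∑ k ∈ Icc (1 : ℕ) 12, 1 / (k : ℝ) ^ 2 := by
    norm_num [sum_Icc_succ_top]
  have hs : ∑ k ∈ Icc (1 : ℕ) 12, (1 - 1 / (k : ℝ) ^ 2) / 6 * expCoeff n =
      (12 - ∑ k ∈ Icc (1 : ℕ) 12, 1 / (k : ℝ) ^ 2) / 6 * expCoeff n := by
    rw [← sum_mul, ← sum_div, sum_sub_distrib]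
    simp
  rw [sum_sub_distrib, hs, ← mul_sum]
  nlinarith [mul_le_mul_of_nonneg_left hA hW, mul_le_mul_of_nonneg_right hA hE.le]

theorem expCoeff_ratio (n : ℕ) (hn : 8 ≤ n) : 0.7 * expCoeff (n + 1) ≤ expCoeff n := by
  induction n, hn using Nat.le_induction with
  | base => norm_num [expCoeff]
  | succ n hn ih =>
    have h := expCoeff_rec n
    have hn : (8 : ℝ) ≤ n := by exact_mod_cast hn
    have h2 := expCoeff_pos (n + 1)
    have h3 : (n + 2) * (0.7 * expCoeff (n + 2)) ≤ (n + 2) * expCoeff (n + 1) := by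
      nlinarith
    exact le_of_mul_le_mul_left h3 (by positivity)

theorem sum_convexExpCoeff_ge (n : ℕ) (hn : 8 ≤ n) :
    (n : ℝ) + 4 ≤ ∑ j ∈ range n, convexExpCoeff j := by
  induction n, hn using Nat.le_induction with
  | base => norm_num [convexExpCoeff, expCoeff, sum_range_succ]
  | succ n hn ih =>
    rw [sum_range_succ, convexExpCoeff_of_ne (by omega)]
    have := expCoeff_mono (Nat.zero_le n)
    have h0 : expCoeff 0 = 1 := by rw [expCoeff]
    push_cast
    linarith

/-! ### Partition sums dominate the comparison sequence -/

theorem partitionSum_recurrence (n : ℕ) :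
    ∑ j ∈ range n, (partitionSum j : ℝ) +
      (∑ v ∈ range (n + 1), (v : ℝ) * partitionSum (n - v) +
        ∑ v ∈ range (n / 2 + 1), (v : ℝ) * partitionSum (n - 2 * v)) ≤
      n * partitionSum n := by
  refine le_trans (le_of_eq ?_) (sum_add_sum_multiplesConv_partitionSum_le n 2)
  congr 1
  simp only [sum_Icc_succ_top (show 1 ≤ 1 + 1 by norm_num), Icc_self, sum_singleton, multiplesConv]
  congr 1
  · refine sum_congr rfl fun v hv => ?_
    rw [one_mul, if_pos (by simp at hv; omega)]
  · rw [← sum_filter]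
    refine sum_congr ?_ fun _ _ => rfl
    ext v
    simp only [mem_range, mem_filter]
    omega

/-- The recurrence truncated at `k ≤ 2` gives lower bounds for the first partition sums; they are
not all sharp but suffice. -/
theorem convexExpCoeff_le_partitionSum_of_lt (n : ℕ) (hn : n < 12) :
    convexExpCoeff n ≤ partitionSum n := by
  have h0 : (1 : ℝ) ≤ partitionSum 0 := by simp [partitionSum_zero]
  have h1 : (2 : ℝ) ≤ partitionSum 1 := by
    have := partitionSum_recurrence 1
    simp only [sum_range_succ, sum_range_zero, Nat.reduceDiv, Nat.reduceMul, Nat.reduceSub,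
      Nat.reduceAdd, Nat.cast_zero, Nat.cast_one] at this
    linarith
  have h2 : (4 : ℝ) ≤ partitionSum 2 := by
    have := partitionSum_recurrence 2
    simp only [sum_range_succ, sum_range_zero, Nat.reduceDiv, Nat.reduceMul, Nat.reduceSub,
      Nat.reduceAdd, Nat.cast_ofNat, Nat.cast_zero, Nat.cast_one] at this
    linarith
  have h3 : (6 : ℝ) ≤ partitionSum 3 := by
    have := partitionSum_recurrence 3
    simp only [sum_range_succ, sum_range_zero, Nat.reduceDiv, Nat.reduceMul, Nat.reduceSub,
      Nat.reduceAdd, Nat.cast_ofNat, Nat.cast_zero, Nat.cast_one] at this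
    linarith
  have h4 : (10 : ℝ) ≤ partitionSum 4 := by
    have := partitionSum_recurrence 4
    simp only [sum_range_succ, sum_range_zero, Nat.reduceDiv, Nat.reduceMul, Nat.reduceSub,
      Nat.reduceAdd, Nat.cast_ofNat, Nat.cast_zero, Nat.cast_one] at this
    linarith
  have h5 : (16 : ℝ) ≤ partitionSum 5 := by
    have := partitionSum_recurrence 5
    simp only [sum_range_succ, sum_range_zero, Nat.reduceDiv, Nat.reduceMul, Nat.reduceSub,
      Nat.reduceAdd, Nat.cast_ofNat, Nat.cast_zero, Nat.cast_one] at this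
    linarith
  have h6 : (24 : ℝ) ≤ partitionSum 6 := by
    have := partitionSum_recurrence 6
    simp only [sum_range_succ, sum_range_zero, Nat.reduceDiv, Nat.reduceMul, Nat.reduceSub,
      Nat.reduceAdd, Nat.cast_ofNat, Nat.cast_zero, Nat.cast_one] at this
    linarith
  have h7 : (35 : ℝ) ≤ partitionSum 7 := by
    have := partitionSum_recurrence 7
    simp only [sum_range_succ, sum_range_zero, Nat.reduceDiv, Nat.reduceMul, Nat.reduceSub,
      Nat.reduceAdd, Nat.cast_ofNat, Nat.cast_zero, Nat.cast_one] at this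
    linarith
  have h8 : (50 : ℝ) ≤ partitionSum 8 := by
    have := partitionSum_recurrence 8
    simp only [sum_range_succ, sum_range_zero, Nat.reduceDiv, Nat.reduceMul, Nat.reduceSub,
      Nat.reduceAdd, Nat.cast_ofNat, Nat.cast_zero, Nat.cast_one] at this
    linarith
  have h9 : (70 : ℝ) ≤ partitionSum 9 := by
    have := partitionSum_recurrence 9
    simp only [sum_range_succ, sum_range_zero, Nat.reduceDiv, Nat.reduceMul, Nat.reduceSub,
      Nat.reduceAdd, Nat.cast_ofNat, Nat.cast_zero, Nat.cast_one] at this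
    linarith
  have h10 : (98 : ℝ) ≤ partitionSum 10 := by
    have := partitionSum_recurrence 10
    simp only [sum_range_succ, sum_range_zero, Nat.reduceDiv, Nat.reduceMul, Nat.reduceSub,
      Nat.reduceAdd, Nat.cast_ofNat, Nat.cast_zero, Nat.cast_one] at this
    linarith
  have h11 : (133 : ℝ) ≤ partitionSum 11 := by
    have := partitionSum_recurrence 11
    simp only [sum_range_succ, sum_range_zero, Nat.reduceDiv, Nat.reduceMul, Nat.reduceSub,
      Nat.reduceAdd, Nat.cast_ofNat, Nat.cast_zero, Nat.cast_one] at this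
    linarith
  have e0 : expCoeff 0 = 1 := by rw [expCoeff]
  have e1 : expCoeff 1 = 25 / 16 := by rw [expCoeff]
  have e2 : expCoeff 2 = 1425 / 512 := by
    have := expCoeff_rec 0
    norm_num [e0, e1] at this
    linarith
  have e3 : expCoeff 3 = 114025 / 24576 := by
    have := expCoeff_rec 1
    norm_num [e1, e2] at this
    linarith
  have e4 : expCoeff 4 = 11608225 / 1572864 := by
    have := expCoeff_rec 2
    norm_num [e2, e3] at this
    linarith
  have e5 : expCoeff 5 = 95051575 / 8388608 := by
    have := expCoeff_rec 3
    norm_num [e3, e4] at this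
    linarith
  have e6 : expCoeff 6 = 40866801725 / 2415919104 := by
    have := expCoeff_rec 4
    norm_num [e4, e5] at this
    linarith
  have e7 : expCoeff 7 = 6678107686325 / 270582939648 := by
    have := expCoeff_rec 5
    norm_num [e5, e6] at this
    linarith
  have e8 : expCoeff 8 = 135938773527525 / 3848290697216 := by
    have := expCoeff_rec 6
    norm_num [e6, e7] at this
    linarith
  have e9 : expCoeff 9 = 248051806459955525 / 4987384743591936 := by
    have := expCoeff_rec 7
    norm_num [e7, e8] at this
    linarith
  have e10 : expCoeff 10 = 11017920831806402425 / 159596311794941952 := by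
    have := expCoeff_rec 8
    norm_num [e8, e9] at this
    linarith
  have e11 : expCoeff 11 = 886053320935244592475 / 9362983625303261184 := by
    have := expCoeff_rec 9
    norm_num [e9, e10] at this
    linarith
  interval_cases n
  · norm_num [convexExpCoeff]; linarith
  all_goals rw [convexExpCoeff_of_ne (by norm_num)]
  · rw [e1]; linarith
  · rw [e2]; linarith
  · rw [e3]; linarith
  · rw [e4]; linarith
  · rw [e5]; linarith
  · rw [e6]; linarith
  · rw [e7]; linarith
  · rw [e8]; linarith
  · rw [e9]; linarith
  · rw [e10]; linarith
  · rw [e11]; linarith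

theorem convexExpCoeff_le_partitionSum (n : ℕ) : convexExpCoeff n ≤ partitionSum n := by
  induction n using Nat.strong_induction_on with
  | _ n ih =>
  rcases lt_or_ge n 12 with hn | hn
  · exact convexExpCoeff_le_partitionSum_of_lt n hn
  have h1 := sum_add_sum_multiplesConv_partitionSum_le n 12
  have h2 := sum_multiplesConv_convexExpCoeff_ge n (by omega)
  have h3 : ∑ k ∈ Icc 1 12, multiplesConv k convexExpCoeff n ≤
      ∑ k ∈ Icc 1 12, multiplesConv k (fun s => (partitionSum s : ℝ)) n := by
    refine sum_le_sum fun k hk => sum_le_sum fun v _ => ?_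
    split_ifs with h
    · rcases Nat.eq_zero_or_pos v with rfl | hv
      · simp
      · have : 0 < k * v := mul_pos (mem_Icc.1 hk).1 hv
        exact mul_le_mul_of_nonneg_left (ih _ (by omega)) v.cast_nonneg
    · exact le_rfl
  have h4 : ∑ j ∈ range n, convexExpCoeff j ≤ ∑ j ∈ range n, (partitionSum j : ℝ) :=
    sum_le_sum fun j hj => ih j (mem_range.1 hj)
  -- The last four terms of the sum contribute at least `0.7 + 0.7² + 0.7³ + 0.7⁴ = 1.7731 > 1.7393`
  -- times `expCoeff n`; the first `n - 4` terms sum to at least `n`, which covers `175/256 * n`.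
  obtain ⟨m, rfl⟩ := Nat.exists_eq_add_of_le' (show 4 ≤ n by omega)
  have h5 := sum_convexExpCoeff_ge m (by omega)
  rw [sum_range_succ, sum_range_succ, sum_range_succ, sum_range_succ] at h4
  rw [convexExpCoeff_of_ne (by omega), convexExpCoeff_of_ne (by omega),
    convexExpCoeff_of_ne (by omega), convexExpCoeff_of_ne (by omega)] at h4
  rw [convexExpCoeff_of_ne (by omega)]
  have r0 := expCoeff_ratio m (by omega)
  have r1 := expCoeff_ratio (m + 1) (by omega)
  have r2 := expCoeff_ratio (m + 2) (by omega)
  have r3 := expCoeff_ratio (m + 3) (by omega)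
  have hE := expCoeff_pos (m + 4)
  have hm : (8 : ℝ) ≤ m := by exact_mod_cast (show 8 ≤ m by omega)
  simp only [add_assoc, Nat.reduceAdd] at *
  have h6 : ((m + 4 : ℕ) : ℝ) * expCoeff (m + 4) ≤ ((m + 4 : ℕ) : ℝ) * partitionSum (m + 4) := by
    push_cast at *
    linarith
  exact le_of_mul_le_mul_left h6 (by positivity)

/-! ### Exponential lower bound for the comparison sequence -/

theorem exp_le_cubic_add (x : ℝ) (hx : |x| ≤ 1) :
    Real.exp x ≤ 1 + x + x ^ 2 / 2 + x ^ 3 / 6 + 5 / 96 * x ^ 4 := by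
  have h := Real.exp_bound hx (n := 4) (by norm_num)
  have h2 := (abs_le.1 h).2
  have h3 : |x| ^ 4 = x ^ 4 := by rw [← abs_pow, abs_of_nonneg (by positivity)]
  rw [h3] at h2
  norm_num [sum_range_succ, Nat.factorial] at h2
  linarith

/-- The quadratic terms match since `(2.5 / 2)² = 25/16`; the cubic term `-5/8 * r ^ 3` absorbs all
higher ones. -/
theorem exp_add_exp_neg_le (r : ℝ) (h0 : 0 < r) (h1 : r ≤ 0.708) :
    Real.exp (2.5 * (r / 2 - r ^ 3 / 8 + r ^ 5 / 16)) +
      Real.exp (-(2.5 * (r / 2 + r ^ 3 / 8))) ≤ 2 + 25 / 16 * r ^ 2 := by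
  have p2 : r ^ 2 ≤ 0.502 := by nlinarith
  have q2 : 0 < r ^ 2 := by positivity
  have hu : |2.5 * (r / 2 - r ^ 3 / 8 + r ^ 5 / 16)| ≤ 1 := by
    rw [abs_le]
    constructor <;> nlinarith [mul_pos h0 q2, mul_pos (mul_pos h0 q2) q2]
  have hw : |-(2.5 * (r / 2 + r ^ 3 / 8))| ≤ 1 := by
    rw [abs_le]
    constructor <;> nlinarith [mul_pos h0 q2, mul_pos (mul_pos h0 q2) q2]
  have e1 := exp_le_cubic_add _ hu
  have e2 := exp_le_cubic_add _ hw
  refine (add_le_add e1 e2).trans ?_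
  have hp : ∀ i, r ^ (i + 4) ≤ 0.708 * r ^ 3 := by
    intro i
    have h3 : 0 < r ^ 3 := by positivity
    have h4 : r ^ i ≤ 1 := pow_le_one₀ h0.le (by linarith)
    calc r ^ (i + 4) = r ^ i * r * r ^ 3 := by ring
      _ ≤ 1 * 0.708 * r ^ 3 := by gcongr
      _ = _ := by ring
  have hn : ∀ i, 0 ≤ r ^ i := fun i => pow_nonneg h0.le i
  linarith [hn 3, hp 0, hp 2, hp 3, hp 4, hp 7, hp 8, hp 11, hp 12, hp 16, hn 5, hn 9, hn 10,
    hn 13, hn 14, hn 18]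

theorem exp_sqrt_convex_bound (n : ℕ) :
    Real.exp (2.5 * √((n + 2 : ℕ) : ℝ)) + Real.exp (2.5 * √(n : ℝ)) ≤
      (2 + 25 / 16 / ((n : ℝ) + 1)) * Real.exp (2.5 * √((n + 1 : ℕ) : ℝ)) := by
  rcases n with _ | n
  · have h2 : √(2 : ℝ) ≤ 1.41422 := Real.sqrt_le_iff.2 (by norm_num)
    have h3 : Real.exp (2.5 * √2) ≤ Real.exp 2.5 * 2.82 := by
      have : Real.exp (2.5 * √2) ≤ Real.exp (2.5 + (1 + 0.03555)) :=
        Real.exp_le_exp.2 (by linarith)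
      refine this.trans ?_
      rw [Real.exp_add, Real.exp_add 1]
      have a1 := Real.exp_one_lt_d9
      have a2 := exp_le_cubic_add 0.03555 (by rw [abs_of_pos] <;> norm_num)
      norm_num at a2
      have : Real.exp 1 * Real.exp 0.03555 ≤ 2.82 := by
        calc _ ≤ 2.7182818286 * (1.0363 : ℝ) := by
              refine mul_le_mul a1.le (by norm_num at a2 ⊢; linarith) (Real.exp_pos _).le (by norm_num)
          _ ≤ _ := by norm_num
      exact mul_le_mul_of_nonneg_left this (Real.exp_pos _).le
    have h4 := Real.add_one_le_exp (2.5 : ℝ)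
    norm_num at h3 h4 ⊢
    linarith
  -- With `r = 1 / s`, the neighbouring roots `√(s² ± 1)` are bounded by truncated Taylor
  -- expansions. Here `s ≥ √2` keeps `r ≤ 0.708`, which is why the first index is treated apart.
  · set s := √((n + 1 + 1 : ℕ) : ℝ) with hs
    have hs2 : s ^ 2 = (n : ℝ) + 2 := by
      rw [hs, Real.sq_sqrt (by positivity)]; push_cast; ring
    have hn : (0 : ℝ) ≤ n := n.cast_nonneg
    have hs0 : 0 < s := by rw [hs]; positivity
    have hs1 : 1.4142 ≤ s := by nlinarith
    have hr : 1 / s ≤ 0.708 := by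
      rw [div_le_iff₀ hs0]; linarith
    have hr0 : 0 < 1 / s := by positivity
    have key := exp_add_exp_neg_le (1 / s) hr0 hr
    set r := 1 / s with hrdef
    have hrs : r * s = 1 := by rw [hrdef]; field_simp
    have b1 : √((n + 1 + 2 : ℕ) : ℝ) ≤ s + (r / 2 - r ^ 3 / 8 + r ^ 5 / 16) := by
      refine Real.sqrt_le_iff.2 ⟨?_, ?_⟩
      · have : r ^ 3 ≤ r := by nlinarith [mul_pos hr0 hr0]
        nlinarith [pow_pos hr0 5]
      · have : (s + (r / 2 - r ^ 3 / 8 + r ^ 5 / 16)) ^ 2 = s ^ 2 + (r * s) +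
          (r ^ 2 - r ^ 2 * (r * s)) / 4 + (r ^ 4 * (r * s) - r ^ 4) / 8 + (r ^ 6 / 64 + r ^ 6 / 16)
            + r ^ 8 * (r ^ 2 / 256 - 1 / 64) := by ring
        rw [this, hrs, hs2]
        push_cast
        have h6 : r ^ 8 ≤ r ^ 6 := pow_le_pow_of_le_one hr0.le (by linarith) (by norm_num)
        nlinarith [pow_pos hr0 6, pow_pos hr0 10]
    have b2 : √((n + 1 : ℕ) : ℝ) ≤ s - (r / 2 + r ^ 3 / 8) := by
      refine Real.sqrt_le_iff.2 ⟨?_, ?_⟩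
      · have : r ^ 3 ≤ r := by nlinarith [mul_pos hr0 hr0]
        nlinarith
      · have : (s - (r / 2 + r ^ 3 / 8)) ^ 2 = s ^ 2 - (r * s) +
          (r ^ 2 - r ^ 2 * (r * s)) / 4 + r ^ 4 / 8 + r ^ 6 / 64 := by ring
        rw [this, hrs, hs2]
        push_cast
        nlinarith [pow_pos hr0 6, pow_pos hr0 4]
    have c1 : Real.exp (2.5 * √((n + 1 + 2 : ℕ) : ℝ)) ≤
        Real.exp (2.5 * s) * Real.exp (2.5 * (r / 2 - r ^ 3 / 8 + r ^ 5 / 16)) := by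
      rw [← Real.exp_add]; exact Real.exp_le_exp.2 (by linarith)
    have c2 : Real.exp (2.5 * √((n + 1 : ℕ) : ℝ)) ≤
        Real.exp (2.5 * s) * Real.exp (-(2.5 * (r / 2 + r ^ 3 / 8))) := by
      rw [← Real.exp_add]; exact Real.exp_le_exp.2 (by linarith)
    have c3 : (25 / 16 / (((n + 1 : ℕ) : ℝ) + 1)) = 25 / 16 * r ^ 2 := by
      rw [hrdef, div_pow, hs2]
      push_cast
      field_simp
      ring
    rw [c3]
    have := mul_le_mul_of_nonneg_left key (Real.exp_pos (2.5 * s)).le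
    linarith

/-- Sturm-type comparison: `y n = n * expCoeff n` satisfies `y (n + 2) + y n = (2 + c / (n + 1)) * y
(n + 1)`, while `exp (2.5 √n)` satisfies it with `≤`. Hence the ratio of `y` to the exponential
never decreases. -/
theorem mul_expCoeff_ratio (n : ℕ) :
    n * expCoeff n * Real.exp (2.5 * √((n + 1 : ℕ) : ℝ)) ≤
      (n + 1) * expCoeff (n + 1) * Real.exp (2.5 * √(n : ℝ)) := by
  induction n with
  | zero =>
    have := expCoeff_pos 1
    simp; positivity
  | succ n ih =>
    have h1 := exp_sqrt_convex_bound n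
    have h2 := expCoeff_rec n
    have hy : 0 < ((n : ℝ) + 1) * expCoeff (n + 1) := mul_pos (by positivity) (expCoeff_pos _)
    have h3 := mul_le_mul_of_nonneg_left h1 hy.le
    have h4 : ((n : ℝ) + 2) * expCoeff (n + 2) =
        (2 + 25 / 16 / ((n : ℝ) + 1)) * (((n : ℝ) + 1) * expCoeff (n + 1)) - n * expCoeff n := by
      rw [h2]; field_simp
    rw [show n + 1 + 1 = n + 2 from rfl]
    have h5 : (((n + 1 : ℕ) : ℝ) + 1) * expCoeff (n + 2) = ((n : ℝ) + 2) * expCoeff (n + 2) := by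
      push_cast; ring
    rw [h5, h4]
    push_cast at *
    linarith

theorem exp_sqrt_div_le_expCoeff (n : ℕ) (hn : 1 ≤ n) :
    Real.exp (2.5 * √(n : ℝ)) / (13 * n) ≤ expCoeff n := by
  have key : Real.exp (2.5 * √(n : ℝ)) ≤ 13 * (n * expCoeff n) := by
    induction n, hn using Nat.le_induction with
    | base =>
      have h1 := Real.exp_one_lt_d9
      have h2 : Real.exp 2.5 ^ 2 = Real.exp 1 ^ 5 := by
        rw [← Real.exp_nat_mul, ← Real.exp_nat_mul]; norm_num
      have h3 : Real.exp 1 ^ 5 ≤ 2.72 ^ 5 :=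
        pow_le_pow_left₀ (Real.exp_pos _).le (by linarith) 5
      have h4 : expCoeff 1 = 25 / 16 := by rw [expCoeff]
      have h5 : Real.exp 2.5 ≤ 20 := by
        refine abs_le_of_sq_le_sq' ?_ (by norm_num) |>.2
        rw [h2]; exact h3.trans (by norm_num)
      rw [h4]
      simp only [Nat.cast_one, Real.sqrt_one]
      linarith
    | succ n hn ih =>
      have h := mul_expCoeff_ratio n
      have hy : 0 < (n : ℝ) * expCoeff n := mul_pos (by exact_mod_cast hn) (expCoeff_pos _)
      have hz : 0 < ((n : ℝ) + 1) * expCoeff (n + 1) := mul_pos (by positivity) (expCoeff_pos _)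
      refine le_of_mul_le_mul_left (a := n * expCoeff n) ?_ hy
      have h2 := mul_le_mul_of_nonneg_left ih hz.le
      push_cast at *
      linarith
  rw [div_le_iff₀ (by positivity)]
  linarith

theorem exp_sqrt_div_le_partitionSum (n : ℕ) (hn : 1 ≤ n) :
    Real.exp (2.5 * √(n : ℝ)) / (13 * n) ≤ partitionSum n := by
  have := convexExpCoeff_le_partitionSum n
  rw [convexExpCoeff_of_ne (by omega)] at this
  exact (exp_sqrt_div_le_expCoeff n hn).trans this

/-! ### Embedding partitions into `T` -/

theorem sigma_partition_ext {x y : Σ s : ℕ, s.Partition} (h : x.2.parts = y.2.parts) : x = y := by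
  obtain ⟨s, x⟩ := x
  obtain ⟨t, y⟩ := y
  have : s = t := by rw [← x.parts_sum, ← y.parts_sum]; exact congrArg Multiset.sum h
  subst this
  congr
  exact Nat.Partition.ext h

/-- Coordinate `i` is the multiplicity of the part `i + 1`. Since `i * k + 1 ≤ k * (i + 1)`, a
partition of `s` has weight at most `k * s < k * l`. -/
theorem sum_card_countRestricted_le_card_exponentVectors (p k l : ℕ) (hk : 0 < k) (hp : 0 < p) :
    ∑ s ∈ range l, #(Nat.Partition.countRestricted s p) ≤
      #(exponentVectors p k l (k * l)) := by
  rw [← card_sigma]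
  refine card_le_card_of_injOn (fun x i => (x.2.parts.count ((i : ℕ) + 1) : ℤ)) ?_ ?_
  · rintro ⟨s, x⟩ hx
    simp only [coe_sigma, Set.mem_sigma_iff, mem_coe, mem_range, Nat.Partition.countRestricted,
      mem_filter, mem_univ, true_and] at hx
    obtain ⟨hs, hx⟩ := hx
    rw [mem_coe, mem_exponentVectors]
    refine ⟨fun i => ⟨by positivity, ?_⟩, ?_⟩
    · have : x.parts.count ((i : ℕ) + 1) < p := by
        by_cases hi : (i : ℕ) + 1 ∈ x.parts
        · exact hx _ hi
        · rw [Multiset.count_eq_zero_of_notMem hi]; exact hp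
      simp only
      omega
    · have h1 := sum_mul_count_parts s (l + 1) (by omega) x
      rw [sum_range_succ', zero_mul, add_zero, ← Fin.sum_univ_eq_sum_range] at h1
      have h2 : ∑ i : Fin l, ((i : ℕ) * k + 1) * x.parts.count ((i : ℕ) + 1) < k * l := by
        calc _ ≤ ∑ i : Fin l, k * (((i : ℕ) + 1) * x.parts.count ((i : ℕ) + 1)) := by
              refine sum_le_sum fun i _ => ?_
              rw [← mul_assoc]
              refine Nat.mul_le_mul_right _ ?_
              nlinarith
          _ = k * s := by rw [← mul_sum, h1]
          _ < k * l := Nat.mul_lt_mul_of_pos_left hs hk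
      simp only
      exact_mod_cast h2
  · rintro ⟨s, x⟩ hx ⟨t, y⟩ hy hxy
    simp only [coe_sigma, Set.mem_sigma_iff, mem_coe, mem_range] at hx hy
    refine sigma_partition_ext (Multiset.ext.2 fun i => ?_)
    rcases i with _ | i
    · rw [Multiset.count_eq_zero_of_notMem fun h => (x.parts_pos h).ne rfl,
        Multiset.count_eq_zero_of_notMem fun h => (y.parts_pos h).ne rfl]
    · by_cases hi : i < l
      · have := congrFun hxy ⟨i, hi⟩
        simp only at this
        exact_mod_cast this
      · rw [Multiset.count_eq_zero_of_notMem fun h => ?_,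
          Multiset.count_eq_zero_of_notMem fun h => ?_]
        · have : i + 1 ≤ t := Nat.Partition.le_of_mem_parts h
          omega
        · have : i + 1 ≤ s := Nat.Partition.le_of_mem_parts h
          omega

theorem partitionSum_le_card_exponentVectors_of_le (p k N : ℕ) (hk : 0 < k) (hN : N < p) :
    partitionSum N ≤ #(exponentVectors p k (N + 1) (k * (N + 1))) := by
  refine le_trans (le_of_eq ?_)
    (sum_card_countRestricted_le_card_exponentVectors p k (N + 1) hk (by omega))
  refine sum_congr rfl fun s hs => ?_
  rw [← card_univ]
  congr 1
  symm
  refine filter_true_of_mem fun x _ i hi => ?_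
  have h1 : x.parts.count i * i ≤ s := by
    have h2 := sum_mul_count_parts s (s + 1) s.lt_succ_self x
    have h3 := single_le_sum (f := fun v => v * x.parts.count v) (fun _ _ => Nat.zero_le _)
      (mem_range.2 (Nat.lt_succ_of_le (Nat.Partition.le_of_mem_parts hi)))
    rw [h2] at h3
    linarith
  have h2 := Nat.le_mul_of_pos_right (x.parts.count i) (x.parts_pos hi)
  have := mem_range.1 hs
  omega

/-- The `j`-th positive integer not divisible by `p`. -/
def nthNotDvd (p j : ℕ) : ℕ := j + (j - 1) / (p - 1)

theorem nthNotDvd_strictMono (p : ℕ) : StrictMono (nthNotDvd p) := by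
  intro i j h
  have : (i - 1) / (p - 1) ≤ (j - 1) / (p - 1) := Nat.div_le_div_right (by omega)
  simp only [nthNotDvd]
  omega

theorem not_dvd_nthNotDvd (p j : ℕ) (hp : 2 ≤ p) (hj : 0 < j) : ¬ p ∣ nthNotDvd p j := by
  have h1 := Nat.div_add_mod (j - 1) (p - 1)
  have h2 := Nat.mod_lt (j - 1) (show 0 < p - 1 by omega)
  set t := (j - 1) / (p - 1) with ht
  set r := (j - 1) % (p - 1)
  obtain ⟨q, rfl⟩ := Nat.exists_eq_add_of_le' hp
  have h3 : nthNotDvd (q + 2) j = (q + 2) * t + (r + 1) := by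
    rw [nthNotDvd, ← ht]
    have : (q + 2 - 1) * t = (q + 1) * t := rfl
    rw [this] at h1
    have : j = (q + 1) * t + r + 1 := by omega
    rw [this]; ring
  rw [h3, Nat.dvd_add_right (Nat.dvd_mul_right _ _)]
  exact Nat.not_dvd_of_pos_of_lt (by omega) (by omega)

theorem nthNotDvd_mul_le (p j : ℕ) (hp : 2 ≤ p) : nthNotDvd p j * (p - 1) ≤ j * p := by
  have h1 := Nat.div_mul_le_self (j - 1) (p - 1)
  obtain ⟨q, rfl⟩ := Nat.exists_eq_add_of_le' hp
  rw [nthNotDvd, add_mul]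
  have h2 : j * (q + 2) = j * (q + 2 - 1) + j := by
    rw [show q + 2 - 1 = q + 1 from rfl]; ring
  omega

/-- Replace each part `j` by the `j`-th integer prime to `p`; this is injective and enlarges the
total by a factor of at most `p / (p - 1)`. -/
theorem partitionSum_le_sum_card_restricted (p M N : ℕ) (hp : 2 ≤ p) (h : M * p ≤ (p - 1) * N) :
    partitionSum M ≤ ∑ s ∈ range (N + 1), #(Nat.Partition.restricted s (¬ p ∣ ·)) := by
  simp_rw [partitionSum, ← card_univ, ← card_sigma]
  let φ : (Σ s : ℕ, s.Partition) → Σ s : ℕ, s.Partition := fun x =>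
    ⟨(x.2.parts.map (nthNotDvd p)).sum,
      { parts := x.2.parts.map (nthNotDvd p)
        parts_pos := by
          intro i hi
          obtain ⟨j, hj, rfl⟩ := Multiset.mem_map.1 hi
          have := x.2.parts_pos hj
          exact Nat.lt_of_lt_of_le this (Nat.le_add_right _ _)
        parts_sum := rfl }⟩
  refine card_le_card_of_injOn φ ?_ ?_
  · rintro ⟨s, x⟩ hx
    simp only [coe_sigma, Set.mem_sigma_iff, mem_coe, mem_range] at hx
    simp only [coe_sigma, Set.mem_sigma_iff, mem_coe, mem_range, Nat.Partition.restricted,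
      mem_filter, mem_univ, true_and, φ]
    constructor
    · have h1 : (x.parts.map (nthNotDvd p)).sum * (p - 1) ≤ s * p := by
        rw [← Multiset.sum_map_mul_right]
        conv_rhs => rw [← x.parts_sum]
        have : x.parts.sum * p = (x.parts.map fun j => j * p).sum := by
          rw [Multiset.sum_map_mul_right, Multiset.map_id']
        rw [this]
        exact Multiset.sum_map_le_sum_map _ _ fun j _ => nthNotDvd_mul_le p j hp
      have h2 : s * p ≤ M * p := Nat.mul_le_mul_right _ (by omega)
      have h3 : (x.parts.map (nthNotDvd p)).sum * (p - 1) ≤ N * (p - 1) := by linarith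
      have := Nat.le_of_mul_le_mul_right h3 (by omega)
      omega
    · intro i hi
      obtain ⟨j, hj, rfl⟩ := Multiset.mem_map.1 hi
      exact not_dvd_nthNotDvd p j hp (x.parts_pos hj)
  · rintro x _ y _ hxy
    have h1 : (φ x).2.parts = (φ y).2.parts := by rw [hxy]
    exact sigma_partition_ext (Multiset.map_injective (nthNotDvd_strictMono p).injective h1)

theorem partitionSum_le_card_exponentVectors (p k M N : ℕ) (hk : 0 < k) (hp : 2 ≤ p)
    (h : M * p ≤ (p - 1) * N) :
    partitionSum M ≤ #(exponentVectors p k (N + 1) (k * (N + 1))) := by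
  refine (partitionSum_le_sum_card_restricted p M N hp h).trans (le_trans (le_of_eq ?_)
    (sum_card_countRestricted_le_card_exponentVectors p k (N + 1) hk (by omega)))
  exact sum_congr rfl fun s _ => Nat.Partition.card_restricted_eq_card_countRestricted s (by omega)

/-! ### The bound `5 ^ √(l / 2)` -/

/-- The vectors supported on the first `r` coordinates that belong to `T` for `p = 5`, `k = 2`
belong to `T` for all `p ≥ 5` and `k ≥ 2`. -/
theorem card_initial_le_card_exponentVectors (p k l r : ℕ) (hp : 5 ≤ p) (hk : 2 ≤ k) (hr : r ≤ l) :
    #{u : Fin r → Fin 5 | ∑ i : Fin r, (2 * (i : ℕ) + 1) * (u i : ℕ) < 2 * l} ≤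
      #(exponentVectors p k l (k * l)) := by
  refine card_le_card_of_injOn
    (fun u i => if h : (i : ℕ) < r then ((u ⟨i, h⟩ : ℕ) : ℤ) else 0) ?_ ?_
  · intro u hu
    have hu : ∑ i : Fin r, (2 * (i : ℕ) + 1) * (u i : ℕ) < 2 * l := by simpa using hu
    rw [mem_coe, mem_exponentVectors]
    constructor
    · intro i
      simp only
      split_ifs with h
      · have := (u ⟨i, h⟩).2
        omega
      · omega
    · have h1 : ∑ i : Fin l, (((i : ℕ) : ℤ) * k + 1) *
          (if h : (i : ℕ) < r then ((u ⟨i, h⟩ : ℕ) : ℤ) else 0) =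
          ((∑ i : Fin r, ((i : ℕ) * k + 1) * (u i : ℕ) : ℕ) : ℤ) := by
        push_cast
        let g : ℕ → ℤ := fun i => ((i : ℤ) * k + 1) *
          (if h : i < r then ((u ⟨i, h⟩ : ℕ) : ℤ) else 0)
        rw [Fin.sum_univ_eq_sum_range g l, ← sum_subset (range_subset_range.2 hr),
          ← Fin.sum_univ_eq_sum_range g r]
        · exact sum_congr rfl fun i _ => by simp [g]
        · intro i _ hi
          simp only [mem_range] at hi
          simp [g, hi]
      simp only
      rw [h1]
      norm_cast
      have h2 : 2 * ∑ i : Fin r, ((i : ℕ) * k + 1) * (u i : ℕ) ≤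
          k * ∑ i : Fin r, (2 * (i : ℕ) + 1) * (u i : ℕ) := by
        rw [mul_sum, mul_sum]
        refine sum_le_sum fun i _ => ?_
        rw [← mul_assoc, ← mul_assoc]
        refine Nat.mul_le_mul_right _ ?_
        linarith [show (k : ℕ) * (2 * (i : ℕ) + 1) = 2 * ((i : ℕ) * k) + k by ring]
      have h3 : k * ∑ i : Fin r, (2 * (i : ℕ) + 1) * (u i : ℕ) < k * (2 * l) :=
        Nat.mul_lt_mul_of_pos_left hu (by omega)
      linarith
  · intro u _ w _ h
    ext i
    have := congrFun h ⟨i, i.2.trans_le hr⟩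
    simpa using this

theorem five_rpow_le_of_sqrt_le (x X : ℝ) (a b : ℕ) (hb : 0 < b) (hX : 0 ≤ X)
    (h1 : x * b ^ 2 ≤ a ^ 2) (h2 : (5 : ℝ) ^ a ≤ X ^ b) : (5 : ℝ) ^ √x ≤ X := by
  have hb' : (0 : ℝ) < b := by exact_mod_cast hb
  have h3 : √x ≤ a / b := by
    refine Real.sqrt_le_iff.2 ⟨by positivity, ?_⟩
    rw [div_pow, le_div_iff₀ (by positivity)]
    exact h1
  calc (5 : ℝ) ^ √x ≤ 5 ^ ((a : ℝ) / b) := Real.rpow_le_rpow_of_exponent_le (by norm_num) h3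
    _ = (5 ^ a : ℝ) ^ (1 / b : ℝ) := by
        rw [← Real.rpow_natCast, ← Real.rpow_mul (by norm_num)]; congr 1; ring
    _ ≤ (X ^ b) ^ (1 / b : ℝ) := Real.rpow_le_rpow (by positivity) h2 (by positivity)
    _ = X := by rw [one_div]; exact Real.pow_rpow_inv_natCast hX hb.ne'

/-- The exponent `√(l / 2) = √(1250 * l) / 50` is rounded up to a multiple of `1/50`; four
coordinates suffice in this range. -/
theorem card_initial_four_pow_ge : ∀ l ∈ Icc 4 31, 5 ^ (Nat.sqrt (1250 * l) + 1) ≤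
    #{u : Fin 4 → Fin 5 | ∑ i : Fin 4, (2 * (i : ℕ) + 1) * (u i : ℕ) < 2 * l} ^ 50 := by
  decide +kernel

theorem four_le_card_exponentVectors_one (p k : ℕ) (hp : 5 ≤ p) (hk : 4 ≤ k) :
    4 ≤ #(exponentVectors p k 1 (k * 1)) := by
  have : #(range 4) ≤ #(exponentVectors p k 1 (k * 1)) := by
    refine card_le_card_of_injOn (fun j _ => (j : ℤ)) ?_ ?_
    · intro j hj
      have hj : j < 4 := by simpa using hj
      rw [mem_coe, mem_exponentVectors]
      constructor
      · intro i
        simp only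
        omega
      · simp
        omega
    · intro i _ j _ h
      simpa using congrFun h 0
  simpa using this

theorem thirteen_mul_sq_le_exp (s : ℝ) (hs : 4.898 ≤ s) :
    13 * s ^ 2 ≤ Real.exp (1.185 * s) := by
  have h1 : (330 : ℝ) ≤ Real.exp 5.804 := by
    have h2 : Real.exp 5.804 = Real.exp 1 ^ 5 * Real.exp 0.804 := by
      rw [← Real.exp_nat_mul, ← Real.exp_add]; norm_num
    have h3 : (2.718 : ℝ) ^ 5 ≤ Real.exp 1 ^ 5 :=
      pow_le_pow_left₀ (by norm_num) (by linarith [Real.exp_one_gt_d9]) 5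
    have h4 := Real.sum_le_exp_of_nonneg (x := 0.804) (by norm_num) 5
    norm_num [sum_range_succ, Nat.factorial] at h4
    have h5 : (2.23 : ℝ) ≤ Real.exp 0.804 := by norm_num; linarith
    rw [h2]
    calc (330 : ℝ) ≤ 2.718 ^ 5 * 2.23 := by norm_num
      _ ≤ _ := mul_le_mul h3 h5 (by norm_num) (by positivity)
  obtain ⟨t, rfl⟩ : ∃ t, s = 4.898 + t := ⟨s - 4.898, by ring⟩
  have ht : 0 ≤ t := by linarith
  have h2 := Real.quadratic_le_exp_of_nonneg (x := 1.185 * t) (by linarith)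
  calc 13 * (4.898 + t) ^ 2 ≤ 330 * (1 + 1.185 * t + (1.185 * t) ^ 2 / 2) := by nlinarith
    _ ≤ Real.exp 5.804 * Real.exp (1.185 * t) :=
        mul_le_mul h1 h2 (by positivity) (Real.exp_pos _).le
    _ ≤ _ := by rw [← Real.exp_add]; exact Real.exp_le_exp.2 (by linarith)

theorem five_le_exp : (5 : ℝ) ≤ Real.exp 1.61 := by
  have h2 : Real.exp 1.61 = Real.exp 1 * Real.exp 0.61 := by
    rw [← Real.exp_add]; norm_num
  have h4 := Real.sum_le_exp_of_nonneg (x := 0.61) (by norm_num) 6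
  norm_num [sum_range_succ, Nat.factorial] at h4
  have h5 : (1.8403 : ℝ) ≤ Real.exp 0.61 := by norm_num; linarith
  rw [h2]
  calc (5 : ℝ) ≤ 2.7182818283 * 1.8403 := by norm_num
    _ ≤ _ := mul_le_mul Real.exp_one_gt_d9.le h5 (by norm_num) (by positivity)

theorem five_rpow_sqrt_le_exp_sqrt_div (l M : ℕ) (hM : 24 ≤ M) (hl : 4 * l ≤ 5 * M + 8) :
    (5 : ℝ) ^ √((l : ℝ) / 2) ≤ Real.exp (2.5 * √(M : ℝ)) / (13 * M) := by
  have hM' : (24 : ℝ) ≤ M := by exact_mod_cast hM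
  have hl' : 4 * (l : ℝ) ≤ 5 * M + 8 := by exact_mod_cast hl
  set s := √(M : ℝ) with hs
  have hs2 : s ^ 2 = M := Real.sq_sqrt (by positivity)
  have hs0 : 4.898 ≤ s := Real.le_sqrt_of_sq_le (by norm_num; linarith)
  have h1 : √((l : ℝ) / 2) ≤ 0.8165 * s := by
    refine Real.sqrt_le_iff.2 ⟨by linarith, ?_⟩
    rw [mul_pow, hs2]
    norm_num
    linarith
  have h2 : (5 : ℝ) ^ √((l : ℝ) / 2) ≤ Real.exp (1.315 * s) := by
    calc (5 : ℝ) ^ √((l : ℝ) / 2) ≤ Real.exp 1.61 ^ √((l : ℝ) / 2) :=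
          Real.rpow_le_rpow (by norm_num) five_le_exp (Real.sqrt_nonneg _)
      _ = Real.exp (1.61 * √((l : ℝ) / 2)) := by rw [← Real.exp_mul]
      _ ≤ _ := Real.exp_le_exp.2 (by linarith)
  rw [le_div_iff₀ (by positivity), ← hs2]
  calc _ ≤ Real.exp (1.315 * s) * Real.exp (1.185 * s) :=
        mul_le_mul h2 (thirteen_mul_sq_le_exp s hs0) (by positivity) (Real.exp_pos _).le
    _ = _ := by rw [← Real.exp_add]; congr 1; ring

theorem five_rpow_sqrt_le_card_exponentVectors (p k l : ℕ) (hp : 5 ≤ p) (hk : 2 ≤ k) (hl : 1 ≤ l)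
    (h : 2 ≤ l ∨ 4 ≤ k) :
    (5 : ℝ) ^ √((l : ℝ) / 2) ≤ (#(exponentVectors p k l (k * l)) : ℝ) := by
  rcases lt_or_ge l 4 with h4 | h4
  · interval_cases l
    · have h1 := four_le_card_exponentVectors_one p k hp (by omega)
      refine le_trans (five_rpow_le_of_sqrt_le _ 4 5 7 ?_ ?_ ?_ ?_) (by exact_mod_cast h1) <;>
        norm_num
    · have h1 := card_initial_le_card_exponentVectors p k 2 2 hp hk le_rfl
      have h2 : #{u : Fin 2 → Fin 5 | ∑ i : Fin 2, (2 * (i : ℕ) + 1) * (u i : ℕ) < 2 * 2} = 5 := by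
        decide +kernel
      rw [h2] at h1
      refine le_trans (five_rpow_le_of_sqrt_le _ 5 1 1 ?_ ?_ ?_ ?_) (by exact_mod_cast h1) <;>
        norm_num
    · have h1 := card_initial_le_card_exponentVectors p k 3 3 hp hk le_rfl
      have h2 : #{u : Fin 3 → Fin 5 | ∑ i : Fin 3, (2 * (i : ℕ) + 1) * (u i : ℕ) < 2 * 3} = 9 := by
        decide +kernel
      rw [h2] at h1
      refine le_trans (five_rpow_le_of_sqrt_le _ 9 5 4 ?_ ?_ ?_ ?_) (by exact_mod_cast h1) <;>
        norm_num
  rcases lt_or_ge l 32 with h32 | h32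
  · have h1 := card_initial_le_card_exponentVectors p k l 4 hp hk h4
    have h2 := card_initial_four_pow_ge l (mem_Icc.2 ⟨h4, by omega⟩)
    have h3 := Nat.lt_succ_sqrt (1250 * l)
    refine le_trans (five_rpow_le_of_sqrt_le _ _ (Nat.sqrt (1250 * l) + 1) 50 (by norm_num)
      (Nat.cast_nonneg _) ?_ (by exact_mod_cast h2)) (Nat.cast_le.2 h1)
    have h4 : (1250 * l : ℝ) ≤ (Nat.sqrt (1250 * l) + 1 : ℕ) * (Nat.sqrt (1250 * l) + 1 : ℕ) := by
      exact_mod_cast h3.le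
    push_cast at h4 ⊢
    linarith
  -- For `p ≥ 5` one has `(p - 1) / p ≥ 4/5`, so `M = 4 * N / 5` is admissible, and `N ≥ 31` gives
  -- `M ≥ 24`.
  · obtain ⟨N, rfl⟩ := Nat.exists_eq_add_of_le' hl
    have hM : 4 * N / 5 * 5 ≤ 4 * N := Nat.div_mul_le_self _ _
    have h1 := partitionSum_le_card_exponentVectors p k (4 * N / 5) N (by omega) (by omega) (by
      obtain ⟨q, rfl⟩ := Nat.exists_eq_add_of_le' hp
      rw [show q + 5 - 1 = q + 4 from rfl]
      nlinarith)
    refine (five_rpow_sqrt_le_exp_sqrt_div _ (4 * N / 5) (by omega) (by omega)).trans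
      ((exp_sqrt_div_le_partitionSum _ (by omega)).trans (Nat.cast_le.2 h1))

/-! ### The bound for `l ≥ p² + 1` -/

theorem mul_sq_le_exp_sqrt (p : ℝ) (hp : 0 ≤ p) : 26 * p ^ 2 ≤ Real.exp (5 * √p) := by
  have h := Real.pow_div_factorial_le_exp (5 * √p) (by positivity) 4
  have h2 : (5 * √p) ^ 4 = 625 * p ^ 2 := by
    rw [mul_pow, show √p ^ 4 = (√p ^ 2) ^ 2 by ring, Real.sq_sqrt hp]; norm_num
  rw [h2] at h
  norm_num [Nat.factorial] at h
  nlinarith [sq_nonneg p]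

/-- Rounding `(1 - 1/p) N` down to `M` costs a factor of at most `2`. As `160 ≥ exp 5` and `p (p -
1) / N ≤ 1`, the power is at most `p (p - 1) / N * exp (-5 √p)`, which by `26 p² ≤ exp (5 √p)`
absorbs `2 * 13 M`. -/
theorem rpow_sqrt_mul_exp_le (p N M : ℝ) (hp : 5 ≤ p) (hN : p ^ 2 ≤ N)
    (hM1 : p * M ≤ (p - 1) * N) (hM2 : (p - 1) * N ≤ p * (M + 1)) :
    (p * (p - 1) / (160 * N)) ^ √p * Real.exp (2.5 * √((1 - 1 / p) * N)) ≤
      Real.exp (2.5 * √M) / (13 * M) := by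
  have hN0 : 0 < N := by nlinarith
  have hM19 : 16 ≤ M := by nlinarith
  have hs : 4 ≤ √M := Real.le_sqrt_of_sq_le (by linarith)
  have hs2 : √M ^ 2 = M := Real.sq_sqrt (by linarith)
  have h1 : √((1 - 1 / p) * N) ≤ √M + 1 / 8 := by
    refine Real.sqrt_le_iff.2 ⟨by linarith, ?_⟩
    have : (1 - 1 / p) * N = (p - 1) * N / p := by field_simp
    rw [this, div_le_iff₀ (by linarith)]
    nlinarith
  have h2 : Real.exp (2.5 * √((1 - 1 / p) * N)) ≤ 2 * Real.exp (2.5 * √M) := by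
    calc _ ≤ Real.exp (2.5 / 8 + 2.5 * √M) := Real.exp_le_exp.2 (by linarith)
      _ = Real.exp (2.5 / 8) * Real.exp (2.5 * √M) := Real.exp_add _ _
      _ ≤ _ := by
        refine mul_le_mul_of_nonneg_right ?_ (Real.exp_pos _).le
        have := exp_le_cubic_add (2.5 / 8) (by rw [abs_of_pos] <;> norm_num)
        refine this.trans (by norm_num)
  have hs1 : 1 ≤ √p := Real.le_sqrt_of_sq_le (by linarith)
  have hA0 : 0 < p * (p - 1) / N := div_pos (mul_pos (by linarith) (by linarith)) hN0
  have h3 : (p * (p - 1) / (160 * N)) ^ √p ≤ p * (p - 1) / N * Real.exp (-(5 * √p)) := by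
    have e : p * (p - 1) / (160 * N) = p * (p - 1) / N * (1 / 160) := by field_simp
    rw [e, Real.mul_rpow hA0.le (by norm_num)]
    refine mul_le_mul ?_ ?_ (by positivity) hA0.le
    · conv_rhs => rw [← Real.rpow_one (p * (p - 1) / N)]
      refine Real.rpow_le_rpow_of_exponent_ge hA0 ?_ hs1
      rw [div_le_one hN0]
      nlinarith
    · have h5 : (1 / 160 : ℝ) ≤ Real.exp (-5) := by
        rw [Real.exp_neg, one_div]
        refine inv_anti₀ (Real.exp_pos _) ?_
        have : Real.exp 5 = Real.exp 1 ^ 5 := by rw [← Real.exp_nat_mul]; norm_num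
        rw [this]
        calc Real.exp 1 ^ 5 ≤ 2.72 ^ 5 :=
              pow_le_pow_left₀ (Real.exp_pos _).le (by linarith [Real.exp_one_lt_d9]) 5
          _ ≤ 160 := by norm_num
      calc (1 / 160 : ℝ) ^ √p ≤ Real.exp (-5) ^ √p :=
            Real.rpow_le_rpow (by norm_num) h5 (by linarith)
        _ = _ := by rw [← Real.exp_mul]; congr 1; ring
  have h6 := mul_sq_le_exp_sqrt p (by linarith)
  have h7 : p * (p - 1) / N * M ≤ p ^ 2 := by
    rw [div_mul_eq_mul_div, div_le_iff₀ hN0]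
    nlinarith [mul_le_mul_of_nonneg_left hM1 (show 0 ≤ p - 1 by linarith)]
  have h8 : p * (p - 1) / N * Real.exp (-(5 * √p)) * (26 * M) ≤ 1 := by
    rw [Real.exp_neg, show p * (p - 1) / N * (Real.exp (5 * √p))⁻¹ * (26 * M) =
      26 * (p * (p - 1) / N * M) / Real.exp (5 * √p) by field_simp, div_le_one (Real.exp_pos _)]
    linarith
  rw [le_div_iff₀ (by linarith)]
  calc _ ≤ p * (p - 1) / N * Real.exp (-(5 * √p)) * (2 * Real.exp (2.5 * √M)) * (13 * M) := by
        refine mul_le_mul_of_nonneg_right ?_ (by linarith)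
        exact mul_le_mul h3 h2 (Real.exp_pos _).le (by positivity)
    _ = p * (p - 1) / N * Real.exp (-(5 * √p)) * (26 * M) * Real.exp (2.5 * √M) := by ring
    _ ≤ 1 * Real.exp (2.5 * √M) := mul_le_mul_of_nonneg_right h8 (Real.exp_pos _).le
    _ = _ := one_mul _

theorem rpow_sqrt_mul_exp_le_card_exponentVectors (p k N : ℕ) (hp : 5 ≤ p) (hk : 0 < k)
    (hN : p ^ 2 ≤ N) :
    ((p : ℝ) * (p - 1) / (160 * N)) ^ √(p : ℝ) *
        Real.exp (2.5 * √((1 - 1 / (p : ℝ)) * N)) ≤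
      (#(exponentVectors p k (N + 1) (k * (N + 1))) : ℝ) := by
  have h1 := Nat.div_add_mod ((p - 1) * N) p
  have h2 := Nat.mod_lt ((p - 1) * N) (show 0 < p by omega)
  set M := (p - 1) * N / p with hM
  have hM1 : p * M ≤ (p - 1) * N := by omega
  have hM2 : (p - 1) * N ≤ p * (M + 1) := by rw [mul_add, mul_one]; omega
  have h3 := partitionSum_le_card_exponentVectors p k M N hk (by omega) (by linarith)
  have hpos : 1 ≤ M := by
    rw [hM, Nat.one_le_div_iff (by omega)]
    have : 1 * N ≤ (p - 1) * N := Nat.mul_le_mul_right _ (by omega)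
    nlinarith
  refine (rpow_sqrt_mul_exp_le p N M (by exact_mod_cast hp) (by exact_mod_cast hN) ?_ ?_).trans
    ((exp_sqrt_div_le_partitionSum M hpos).trans (Nat.cast_le.2 h3))
  · have := (Nat.cast_le (α := ℝ)).2 hM1
    rwa [Nat.cast_mul, Nat.cast_mul, Nat.cast_sub (by omega), Nat.cast_one] at this
  · have := (Nat.cast_le (α := ℝ)).2 hM2
    rwa [Nat.cast_mul, Nat.cast_mul, Nat.cast_sub (by omega), Nat.cast_one, Nat.cast_add,
      Nat.cast_one] at this

end Partitions

/-! ### The multiplicative order of `θ + b` -/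

section Order

open Finset Polynomial

/-- `P` agrees with `β * (1 + δ * X ^ N)` up to terms of degree greater than `N`. -/
def HasLowTerms {F : Type*} [Field F] (N : ℕ) (P : F[X]) (β δ : F) : Prop :=
  X ^ (N + 1) ∣ P - C β * (1 + C δ * X ^ N)

namespace HasLowTerms

variable {F : Type*} [Field F] {N : ℕ}

/-- The normalised coefficient `δ` is additive under products, like a logarithm, so exponents can be
read off from it. -/
theorem mul (hN : 0 < N) {P P' : F[X]} {β β' δ δ' : F} (h : HasLowTerms N P β δ)
    (h' : HasLowTerms N P' β' δ') : HasLowTerms N (P * P') (β * β') (δ + δ') := by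
  obtain ⟨A, hA⟩ := h
  obtain ⟨B, hB⟩ := h'
  rw [sub_eq_iff_eq_add] at hA hB
  obtain ⟨M, rfl⟩ := Nat.exists_eq_add_of_le' hN
  refine ⟨A * P' + C β * (1 + C δ * X ^ (M + 1)) * B + C (β * β' * δ * δ') * X ^ M, ?_⟩
  rw [hA, hB]
  simp only [map_mul, map_add]
  ring

theorem one (N : ℕ) : HasLowTerms N (1 : F[X]) 1 0 := by
  simp [HasLowTerms]

theorem pow (hN : 0 < N) {P : F[X]} {β δ : F} (h : HasLowTerms N P β δ) (u : ℕ) :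
    HasLowTerms N (P ^ u) (β ^ u) (u * δ) := by
  induction u with
  | zero => simpa using one N
  | succ u ih =>
    have := ih.mul hN h
    rw [pow_succ, pow_succ]
    convert this using 1
    push_cast; ring

theorem prod (hN : 0 < N) {ι : Type*} (s : Finset ι) (P : ι → F[X]) (β δ : ι → F)
    (h : ∀ i ∈ s, HasLowTerms N (P i) (β i) (δ i)) :
    HasLowTerms N (∏ i ∈ s, P i) (∏ i ∈ s, β i) (∑ i ∈ s, δ i) := by
  classical
  induction s using Finset.induction_on with
  | empty => simpa using one N
  | insert a s ha ih =>
    rw [prod_insert ha, prod_insert ha, sum_insert ha]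
    exact (h a (mem_insert_self _ _)).mul hN (ih fun i hi => h i (mem_insert_of_mem hi))

theorem unique (hN : 0 < N) {P : F[X]} {β β' δ δ' : F} (h : HasLowTerms N P β δ)
    (h' : HasLowTerms N P β' δ') (hβ : β ≠ 0) : δ = δ' := by
  have h1 := dvd_sub h h'
  have h2 : P - C β * (1 + C δ * X ^ N) - (P - C β' * (1 + C δ' * X ^ N)) =
      C (β' - β) + C (β' * δ' - β * δ) * X ^ N := by
    simp only [map_sub, map_mul]; ring
  rw [h2, X_pow_dvd_iff] at h1
  have h3 := h1 0 (by omega)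
  have h4 := h1 N (by omega)
  simp only [coeff_add, coeff_C_mul, coeff_X_pow, coeff_C] at h3 h4
  simp only [if_neg hN.ne, if_neg hN.ne', if_true, mul_zero, add_zero, zero_add, mul_one] at h3 h4
  have h5 : β' = β := sub_eq_zero.1 h3
  rw [h5, ← mul_sub] at h4
  rcases mul_eq_zero.1 h4 with h | h
  · exact absurd h hβ
  · exact (sub_eq_zero.1 h).symm

theorem binomial (hN : 0 < N) (d b : F) (hb : b ≠ 0) (n : ℕ) (hn : N ≤ n) :
    HasLowTerms N (C d * X ^ n + C b) b (if n = N then d / b else 0) := by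
  split_ifs with h
  · subst h
    have : C d * X ^ n + C b - C b * (1 + C (d / b) * X ^ n) = 0 := by
      have hd : C b * C (d / b) = C d := by rw [← C_mul]; congr 1; field_simp
      rw [mul_add, ← mul_assoc, hd]; ring
    rw [HasLowTerms, this]
    exact dvd_zero _
  · have : C d * X ^ n + C b - C b * (1 + C 0 * X ^ N) = X ^ n * C d := by
      simp
    rw [HasLowTerms, this]
    exact (pow_dvd_pow X (by omega)).mul_right _

end HasLowTerms

/-- Products of powers of binomials `d i * X ^ n i + b` determine the exponents modulo the
characteristic. -/
theorem prod_binomial_pow_injective {F : Type*} [Field F] (p : ℕ) [CharP F p] {l : ℕ}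
    (n : Fin l → ℕ) (hn : StrictMono n) (hn0 : ∀ i, 0 < n i) (d : Fin l → F) (hd : ∀ i, d i ≠ 0)
    (b : F) (hb : b ≠ 0) (u v : Fin l → ℕ) (hu : ∀ i, u i < p) (hv : ∀ i, v i < p)
    (h : ∏ i, (C (d i) * X ^ n i + C b) ^ u i = ∏ i, (C (d i) * X ^ n i + C b) ^ v i) : u = v := by
  funext t
  induction t using WellFoundedLT.induction with
  | _ t ih =>
  have hg0 : ∀ i, (C (d i) * X ^ n i + C b : F[X]) ≠ 0 := by
    intro i h0
    have := congrArg (fun P => coeff P 0) h0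
    simp [coeff_X_pow, (hn0 i).ne] at this
    exact hb this
  have hsplit := h
  rw [← prod_filter_mul_prod_filter_not univ (fun i => i < t) fun i =>
      (C (d i) * X ^ n i + C b) ^ u i,
    ← prod_filter_mul_prod_filter_not univ (fun i => i < t) fun i =>
      (C (d i) * X ^ n i + C b) ^ v i,
    prod_congr rfl fun i hi => by rw [ih i (mem_filter.1 hi).2]] at hsplit
  have hcancel := mul_left_cancel₀
    (prod_ne_zero_iff.2 fun i _ => pow_ne_zero _ (hg0 i)) hsplit
  -- Once the factors below `t` are cancelled, only the factor at `t` affects the coefficient of `X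
  -- ^ n t`, and it contributes `w t * (d t / b)`.
  have key : ∀ w : Fin l → ℕ, HasLowTerms (n t)
      (∏ i ∈ univ.filter (fun i => ¬ i < t), (C (d i) * X ^ n i + C b) ^ w i)
      (∏ i ∈ univ.filter (fun i => ¬ i < t), b ^ w i) (w t * (d t / b)) := by
    intro w
    have h1 := HasLowTerms.prod (hn0 t) (univ.filter fun i => ¬ i < t)
      (fun i => (C (d i) * X ^ n i + C b) ^ w i) (fun i => b ^ w i)
      (fun i => w i * if n i = n t then d i / b else 0) fun i hi =>
        (HasLowTerms.binomial (hn0 t) (d i) b hb (n i)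
          (hn.monotone (not_lt.1 (mem_filter.1 hi).2))).pow (hn0 t) (w i)
    rw [sum_eq_single t] at h1
    · simpa using h1
    · intro i _ hi
      rw [if_neg fun h => hi (hn.injective h), mul_zero]
    · intro ht
      simp at ht
  have h1 := key u
  rw [hcancel] at h1
  have h2 := h1.unique (hn0 t) (key v) (prod_ne_zero_iff.2 fun i _ => pow_ne_zero _ hb)
  have h3 : (u t : F) = v t := mul_right_cancel₀ (div_ne_zero (hd t) hb) h2
  exact Nat.ModEq.eq_of_lt_of_lt ((CharP.natCast_eq_natCast F p).1 h3) (hu t) (hv t)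

/-- Every residue of `q ^ i` is `1` mod `k`, so it is one of the `l` numbers `j * k + 1`. For `i <
l` the residues are distinct, hence all occur. -/
theorem exists_pow_card_pow_eq (q m k l : ℕ) (hm : m = k * l) (hk : 1 < k) (hl : 1 ≤ l)
    (hkq : q ≡ 1 [MOD k]) (hord : orderOf (q : ZMod m) = l) (j : Fin l) :
    ∃ i, q ^ i % m = j * k + 1 := by
  have hr : ∀ i, q ^ i % m = (q ^ i % m / k) * k + 1 := by
    intro i
    have h1 : q ^ i % m % k = 1 := by
      rw [Nat.mod_mod_of_dvd _ (hm ▸ Nat.dvd_mul_right k l)]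
      have := hkq.pow i
      rw [one_pow] at this
      rw [this, Nat.mod_eq_of_lt hk]
    have h2 := Nat.div_add_mod (q ^ i % m) k
    rw [h1] at h2
    linarith
  have hlt : ∀ i, q ^ i % m / k < l := by
    intro i
    rw [Nat.div_lt_iff_lt_mul (by omega), mul_comm, ← hm]
    exact Nat.mod_lt _ (by rw [hm]; positivity)
  let g : Fin l → Fin l := fun i => ⟨q ^ (i : ℕ) % m / k, hlt i⟩
  have hg : Function.Injective g := by
    intro i i' h
    have h1 : q ^ (i : ℕ) % m / k = q ^ (i' : ℕ) % m / k := congrArg Fin.val h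
    have h2 : q ^ (i : ℕ) % m = q ^ (i' : ℕ) % m := by rw [hr, h1, ← hr]
    have h3 : (q : ZMod m) ^ (i : ℕ) = (q : ZMod m) ^ (i' : ℕ) := by
      have := (ZMod.natCast_eq_natCast_iff' _ _ m).2 h2
      exact_mod_cast this
    exact Fin.ext (pow_injOn_Iio_orderOf (by simp [hord]) (by simp [hord]) h3)
  obtain ⟨i, hi⟩ := (Finite.injective_iff_surjective.1 hg) j
  refine ⟨i, ?_⟩
  rw [hr, show q ^ (i : ℕ) % m / k = j from congrArg Fin.val hi]

theorem card_exponentVectors_le_orderOf {F : Type*} [Field F] [Finite F] (p n q m k l : ℕ)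
    (hp : p.Prime) (hq : q = p ^ n) (hF : Nat.card F = q) (hm : m = k * l) (hk : 1 < k)
    (hkq : k ∣ q - 1) (hl : 1 ≤ l) (hord : orderOf (q : ZMod m) = l) (a : F) (ha : a ≠ 0)
    (hirr : Irreducible (X ^ m - C a : F[X])) (b : F) (hb : b ≠ 0) :
    #(exponentVectors p k l m) ≤
      orderOf (AdjoinRoot.root (X ^ m - C a : F[X]) + AdjoinRoot.of (X ^ m - C a : F[X]) b) := by
  have hm2 : 2 ≤ m := by rw [hm]; nlinarith
  have : Fact p.Prime := ⟨hp⟩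
  have : Fintype F := Fintype.ofFinite F
  have hcard : Fintype.card F = q := by rw [← hF, Nat.card_eq_fintype_card]
  have : CharP F p := charP_of_card_eq_prime_pow (hcard.trans hq)
  have : Fact (Irreducible (X ^ m - C a : F[X])) := ⟨hirr⟩
  have hmonic : (X ^ m - C a : F[X]).Monic := monic_X_pow_sub_C a (by omega)
  have hdeg : (X ^ m - C a : F[X]).natDegree = m := natDegree_X_pow_sub_C
  have : CharP (AdjoinRoot (X ^ m - C a : F[X])) p :=
    charP_of_injective_algebraMap (AdjoinRoot.of (X ^ m - C a : F[X])).injective p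
  have : Module.Finite F (AdjoinRoot (X ^ m - C a : F[X])) := hmonic.finite_adjoinRoot
  have : Finite (AdjoinRoot (X ^ m - C a : F[X])) := Module.finite_of_finite F
  have hmk : ∀ P Q : F[X], P.natDegree < m → Q.natDegree < m →
      AdjoinRoot.mk (X ^ m - C a) P = AdjoinRoot.mk (X ^ m - C a) Q → P = Q := by
    intro P Q hP hQ h
    rw [AdjoinRoot.mk_eq_mk] at h
    refine sub_eq_zero.1 (eq_zero_of_dvd_of_natDegree_lt h ?_)
    rw [hdeg]
    exact (natDegree_sub_le P Q).trans_lt (max_lt hP hQ)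
  have hq1 : 1 ≤ q := by rw [hq]; exact Nat.pow_pos hp.pos
  have hkq' : q ≡ 1 [MOD k] := ((Nat.modEq_iff_dvd' hq1).2 hkq).symm
  choose e he using exists_pow_card_pow_eq q m k l hm hk hl hkq' hord
  let d : Fin l → F := fun j => a ^ (q ^ e j / m)
  let g : Fin l → F[X] := fun j => C (d j) * X ^ ((j : ℕ) * k + 1) + C b
  set x := AdjoinRoot.root (X ^ m - C a : F[X]) + AdjoinRoot.of (X ^ m - C a : F[X]) b with hx
  have hroot : AdjoinRoot.root (X ^ m - C a : F[X]) ^ m = AdjoinRoot.of (X ^ m - C a : F[X]) a := by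
    have h := AdjoinRoot.eval₂_root (X ^ m - C a : F[X])
    simpa [sub_eq_zero] using h
  have hconj : ∀ j, AdjoinRoot.mk (X ^ m - C a) (g j) = x ^ q ^ e j := by
    intro j
    have h1 : x ^ q ^ e j = AdjoinRoot.root (X ^ m - C a : F[X]) ^ q ^ e j +
        AdjoinRoot.of (X ^ m - C a : F[X]) b ^ q ^ e j := by
      rw [hx, hq, ← pow_mul, add_pow_char_pow]
    have h2 : b ^ q ^ e j = b := by rw [← hcard]; exact FiniteField.pow_card_pow _ b
    rw [h1, ← map_pow, h2, ← Nat.div_add_mod (q ^ e j) m, he, pow_add, pow_mul, hroot, ← map_pow]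
    simp [g, d, AdjoinRoot.mk_C, AdjoinRoot.mk_X]
  have hx0 : x ≠ 0 := by
    intro h
    have h1 : AdjoinRoot.mk (X ^ m - C a) (X + C b) = AdjoinRoot.mk (X ^ m - C a) 0 := by
      rw [map_add, AdjoinRoot.mk_X, AdjoinRoot.mk_C, map_zero]; exact h
    have h2 := hmk _ _ (by rw [natDegree_X_add_C]; omega) (by rw [natDegree_zero]; omega) h1
    exact X_add_C_ne_zero b h2
  have hpos : 0 < orderOf x :=
    Nat.pos_of_ne_zero fun h => hx0 (orderOf_eq_zero_iff_eq_zero.1 h)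
  -- Exponents of `x` reduced modulo its order: distinct vectors of `T` give distinct powers of `x`.
  have hinj : Set.InjOn (fun u : Fin l → ℤ => (∑ j, q ^ e j * (u j).toNat) % orderOf x)
      (exponentVectors p k l m) := by
    have hT : ∀ u ∈ exponentVectors p k l m, (∀ j, (u j).toNat < p) ∧
        (∏ j, g j ^ (u j).toNat).natDegree < m := by
      intro u hu
      rw [mem_exponentVectors] at hu
      obtain ⟨h1, h2⟩ := hu
      refine ⟨fun j => by have := h1 j; have := hp.pos; omega, ?_⟩
      have h3 : ∑ j : Fin l, ((j : ℕ) * k + 1) * (u j).toNat < m := by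
        zify
        refine lt_of_eq_of_lt (sum_congr rfl fun j _ => ?_) h2
        rw [Int.toNat_of_nonneg (h1 j).1]
      refine lt_of_le_of_lt ((natDegree_prod_le _ _).trans (sum_le_sum fun j _ => ?_)) h3
      refine natDegree_pow_le.trans ?_
      rw [mul_comm]
      refine Nat.mul_le_mul_right _ ?_
      refine natDegree_add_le_of_degree_le (natDegree_C_mul_X_pow_le _ _) ?_
      rw [natDegree_C]; exact Nat.zero_le _
    have hpow : ∀ u : Fin l → ℤ, AdjoinRoot.mk (X ^ m - C a) (∏ j, g j ^ (u j).toNat) =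
        x ^ ((∑ j, q ^ e j * (u j).toNat) % orderOf x) := by
      intro u
      rw [pow_mod_orderOf, map_prod, ← prod_pow_eq_pow_sum]
      refine prod_congr rfl fun j _ => ?_
      rw [map_pow, hconj, ← pow_mul]
    intro u hu v hv huv
    simp only at huv
    have h1 := hmk _ _ (hT u hu).2 (hT v hv).2 (by rw [hpow, hpow, huv])
    have h2 := prod_binomial_pow_injective p (fun j : Fin l => (j : ℕ) * k + 1)
      (fun i j hij => by
        have : (i : ℕ) * k < (j : ℕ) * k := Nat.mul_lt_mul_of_pos_right hij (by omega)
        simpa using this)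
      (fun j => Nat.succ_pos _) d (fun j => pow_ne_zero _ ha) b hb _ _ (hT u hu).1 (hT v hv).1 h1
    funext j
    have h3 := congrFun h2 j
    have h4 := (((mem_exponentVectors _ _ _ _ _).1 hu).1 j).1
    have h5 := (((mem_exponentVectors _ _ _ _ _).1 hv).1 j).1
    omega
  calc #(exponentVectors p k l m) ≤ #(range (orderOf x)) :=
        card_le_card_of_injOn _ (fun u _ => by simpa using Nat.mod_lt _ hpos) hinj
    _ = orderOf x := card_range _

end Order

theorem theorem2 {F : Type*} [Field F] [Finite F] (p n q m k l : ℕ)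
    (hp : p.Prime) (hp5 : 5 ≤ p) (hq : q = p ^ n) (hF : Nat.card F = q)
    (hm : m = k * l) (hk : 1 < k) (hkq : k ∣ q - 1)
    (hl : 1 ≤ l) (hord : orderOf (q : ZMod m) = l)
    (a : F) (ha : a ≠ 0)
    (hirr : Irreducible (Polynomial.X ^ m - Polynomial.C a : Polynomial F))
    (b : F) (hb : b ≠ 0) :
    (exponentVectors p k l m).card ≤
        orderOf (AdjoinRoot.root (Polynomial.X ^ m - Polynomial.C a : Polynomial F) +
          AdjoinRoot.of (Polynomial.X ^ m - Polynomial.C a : Polynomial F) b) ∧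
    ((2 ≤ l ∨ 4 ≤ k) →
      (5 : ℝ) ^ Real.sqrt ((l : ℝ) / 2) ≤ ((exponentVectors p k l m).card : ℝ)) ∧
    (p ^ 2 + 1 ≤ l →
      ((p : ℝ) * ((p : ℝ) - 1) / (160 * ((l : ℝ) - 1))) ^ Real.sqrt (p : ℝ) *
          Real.exp (2.5 * Real.sqrt ((1 - 1 / (p : ℝ)) * ((l : ℝ) - 1))) ≤
        ((exponentVectors p k l m).card : ℝ)) ∧
    (2 ≤ l → l < p + 1 →
      Real.exp (2.5 * Real.sqrt ((l : ℝ) - 1)) / (13 * ((l : ℝ) - 1)) ≤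
        ((exponentVectors p k l m).card : ℝ)) := by
  refine ⟨card_exponentVectors_le_orderOf p n q m k l hp hq hF hm hk hkq hl hord a ha hirr b hb,
    ?_⟩
  subst hm
  refine ⟨five_rpow_sqrt_le_card_exponentVectors p k l hp5 hk hl, ?_⟩
  obtain ⟨N, rfl⟩ := Nat.exists_eq_add_of_le' hl
  have hN : ((N + 1 : ℕ) : ℝ) - 1 = N := by push_cast; ring
  rw [hN]
  refine ⟨fun h => rpow_sqrt_mul_exp_le_card_exponentVectors p k N hp5 (by omega) (by omega),
    fun h1 h2 => ?_⟩
  exact (exp_sqrt_div_le_partitionSum N (by omega)).trans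
    (Nat.cast_le.2 (partitionSum_le_card_exponentVectors_of_le p k N (by omega) (by omega)))
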